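/- Theorem. Let $\mathbb{K}$ be $\mathbb{R}$ or $\mathbb{C}$, and equip $\mathbb{K}^{M\times N}$ with the Frobenius norm $\|\cdot\|_2$ and the corresponding inner product $\langle\cdot,\cdot\rangle$. Let $\sigma_0\ge 0$, $\alpha>0$, $F\in\mathbb{K}^{M\times N}$, let $\mathcal{M}\subset\mathbb{K}^{M\times N}$ be a linear subspace, and let $\mathcal{P}_{\mathcal{M}^\perp}$ be the orthogonal projection onto $\mathcal{M}^\perp$. Put $$\mathscr{N}_F(X)=\sigma_0^2\,\mathrm{rank}(X)+\|X-F\|_2^2 ,$$ and let $\mathscr{N}_F^{**}$ be its double Fenchel conjugate, where $\mathscr{J}^*(Y)=\sup_X\,\mathrm{Re}\langle X,Y\rangle-\mathscr{J}(X)$. Define $$f_\alpha(x)=\begin{cases}0 & x<\sigma_0,\\ \frac{2}{\alpha}(x-\sigma_0) & \sigma_0\le x<(1+\frac{\alpha}{2})\sigma_0,\\ (1+\frac{\alpha}{2})^{-1}x & (1+\frac{\alpha}{2})\sigma_0\le x,\end{cases}$$ and, for a matrix $A$ with singular value decomposition $A=U\Sigma_\phi V^*$, $\phi=(\phi_j)_{j=1}^{\min(M,N)}$,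 let $\mathfrak{S}_{f_\alpha}(A)=U\Sigma_{f_\alpha(\phi)}V^*$ (this does not depend on the choice of the decomposition, since $f_\alpha(0)=0$). Let the sequences $(X^n)_{n\ge1}$ and $(\Lambda^n)_{n\ge0}$ be given by $\Lambda^0=0$ and $$X^{n+1}=\mathfrak{S}_{f_\alpha}\!\left(F-\tfrac12\Lambda^n\right),\qquad \Lambda^{n+1}=\Lambda^n+\alpha\,\mathcal{P}_{\mathcal{M}^\perp}(X^{n+1}).$$ Then $(X^n)$ and $(\Lambda^n)$ converge to some limits $X^\star$ and $\Lambda^\star$, and $X^\star$ is the unique solution of $$\operatorname*{argmin}_{X\in\mathcal{M}}\ \mathscr{N}_F^{**}(X)+\frac{\alpha}{2}\|X\|_2^2 .$$ -/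

import Mathlib

open Filter Topology Matrix

section FrobeniusHilbertSpace

/-! The space of `M × N` matrices over `𝕜 = ℝ` or `ℂ`, as a finite dimensional Hilbert space with
the Frobenius norm and the inner product `⟪A, B⟫ = ∑ i j, conj (A i j) * B i j`. -/

attribute [local instance] Matrix.frobeniusNormedAddCommGroup Matrix.frobeniusNormedSpace

theorem frobenius_norm_sq {𝕜 : Type*} [RCLike 𝕜] {m n : Type*} [Fintype m] [Fintype n]
    (A : Matrix m n 𝕜) : ‖A‖ ^ 2 = ∑ i, ∑ j, ‖A i j‖ ^ 2 := by
  rw [Matrix.frobenius_norm_def, ← Real.sqrt_eq_rpow, Real.sq_sqrt]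
  · simp
  · positivity

noncomputable instance frobeniusInnerProductSpace {𝕜 : Type*} [RCLike 𝕜] {m n : Type*}
    [Fintype m] [Fintype n] : InnerProductSpace 𝕜 (Matrix m n 𝕜) where
  toNormedSpace := Matrix.frobeniusNormedSpace
  inner A B := ∑ i, ∑ j, starRingEnd 𝕜 (A i j) * B i j
  norm_sq_eq_re_inner A := by
    rw [frobenius_norm_sq]
    simp only [map_sum, RCLike.conj_mul, ← RCLike.ofReal_pow, RCLike.ofReal_re]
  conj_inner_symm A B := by
    simp [map_sum, mul_comm]
  add_left A B C := by
    simp [add_mul, Finset.sum_add_distrib]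
  smul_left A B r := by
    simp [Finset.mul_sum, mul_assoc]

end FrobeniusHilbertSpace

attribute [local instance] Matrix.frobeniusNormedAddCommGroup Matrix.frobeniusNormedSpace

/-- The `M × N` matrix `Σ_φ` with the numbers `φ_j`, `j < min M N`, on its main diagonal. -/
def rectDiagonal (𝕜 : Type*) [RCLike 𝕜] {M N : ℕ} (φ : Fin (min M N) → ℝ) :
    Matrix (Fin M) (Fin N) 𝕜 :=
  Matrix.of fun i j =>
    if h : (i : ℕ) = (j : ℕ) then
      ((φ ⟨i, lt_min i.isLt (lt_of_eq_of_lt h j.isLt)⟩ : ℝ) : 𝕜)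
    else 0

/-- `A = U Σ_φ V^*` is a singular value decomposition of `A`. -/
structure IsSVD {𝕜 : Type*} [RCLike 𝕜] {M N : ℕ} (A : Matrix (Fin M) (Fin N) 𝕜)
    (U : Matrix (Fin M) (Fin M) 𝕜) (φ : Fin (min M N) → ℝ) (V : Matrix (Fin N) (Fin N) 𝕜) :
    Prop where
  unitary_left : U ∈ Matrix.unitaryGroup (Fin M) 𝕜
  unitary_right : V ∈ Matrix.unitaryGroup (Fin N) 𝕜
  nonneg : ∀ j, 0 ≤ φ j
  antitone : Antitone φ
  eq_mul : A = U * rectDiagonal 𝕜 φ * Vᴴ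

/-- Every matrix has a singular value decomposition. -/
theorem exists_isSVD {𝕜 : Type*} [RCLike 𝕜] {M N : ℕ} (A : Matrix (Fin M) (Fin N) 𝕜) :
    ∃ U φ V, IsSVD A U φ V := by
  classical
  let T := Matrix.toEuclideanLin A
  have hN : Module.finrank 𝕜 (EuclideanSpace 𝕜 (Fin N)) = N := by simp
  have hM : Module.finrank 𝕜 (EuclideanSpace 𝕜 (Fin M)) = M := by simp
  let v := T.isSymmetric_adjoint_comp_self.eigenvectorBasis hN
  have hTT : ∀ i j, inner 𝕜 (T (v i)) (T (v j)) =
      if i = j then ((T.singularValues j ^ 2 : ℝ) : 𝕜) else 0 := by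
    intro i j
    have h1 : LinearMap.adjoint T (T (v j)) = ((T.singularValues j ^ 2 : ℝ) : 𝕜) • v j := by
      rw [T.sq_singularValues_fin hN]
      exact T.isSymmetric_adjoint_comp_self.apply_eigenvectorBasis hN j
    rw [← LinearMap.adjoint_inner_right, h1, inner_smul_right,
      orthonormal_iff_ite.mp v.orthonormal i j]
    split_ifs <;> simp
  let w : Fin M → EuclideanSpace 𝕜 (Fin M) := fun i =>
    if h : (i : ℕ) < N then ((T.singularValues i : ℝ) : 𝕜)⁻¹ • T (v ⟨i, h⟩) else 0
  let s : Set (Fin M) := {i | (i : ℕ) < N ∧ T.singularValues i ≠ 0}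
  have hw : Orthonormal 𝕜 (s.domRestrict w) := by
    rw [orthonormal_iff_ite]
    rintro ⟨i, hi, hi'⟩ ⟨j, hj, hj'⟩
    simp only [Set.domRestrict_apply, w, hi, hj, dif_pos, inner_smul_left, inner_smul_right, hTT]
    by_cases hij : i = j
    · subst hij
      have : ((T.singularValues i : ℝ) : 𝕜) ≠ 0 := by exact_mod_cast hi'
      simp
      field_simp
    · have : ¬ (i : ℕ) = j := fun h => hij (Fin.ext h)
      simp [hij, this]
  obtain ⟨u, hu⟩ := hw.exists_orthonormalBasis_extension_of_card_eq (by simp)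
  have hrank : ∀ k, M ≤ k → T.singularValues k = 0 := by
    intro k hk
    rw [T.singularValues_eq_zero_iff_le_finrank_range]
    exact (Submodule.finrank_le _).trans (hM.le.trans hk)
  have hzero : ∀ j : Fin N, T.singularValues j = 0 → T (v j) = 0 := by
    intro j hj
    have := hTT j j
    rw [hj] at this
    simpa using this
  have hcol : ∀ (j : Fin N) (h : (j : ℕ) < M),
      T (v j) = ((T.singularValues j : ℝ) : 𝕜) • u ⟨j, h⟩ := by
    intro j h
    by_cases h0 : T.singularValues j = 0
    · rw [hzero j h0, h0]; simp
    · have h0' : ((T.singularValues j : ℝ) : 𝕜) ≠ 0 := by exact_mod_cast h0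
      rw [hu ⟨j, h⟩ ⟨j.isLt, h0⟩]
      simp [w, smul_smul, h0']
  let U : Matrix (Fin M) (Fin M) 𝕜 := Matrix.of fun i j => u j i
  let V : Matrix (Fin N) (Fin N) 𝕜 := Matrix.of fun i j => v j i
  have hU : U ∈ Matrix.unitaryGroup (Fin M) 𝕜 := by
    convert (EuclideanSpace.basisFun (Fin M) 𝕜).toMatrix_orthonormalBasis_mem_unitary u using 1
    ext i j
    simp [U, Module.Basis.toMatrix_apply]
  have hV : V ∈ Matrix.unitaryGroup (Fin N) 𝕜 := by
    convert (EuclideanSpace.basisFun (Fin N) 𝕜).toMatrix_orthonormalBasis_mem_unitary v using 1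
    ext i j
    simp [V, Module.Basis.toMatrix_apply]
  let φ : Fin (min M N) → ℝ := fun j => T.singularValues j
  have hAV : A * V = U * rectDiagonal 𝕜 φ := by
    ext i j
    have h1 : (A * V) i j = T (v j) i := by
      simp [T, V, Matrix.mul_apply, Matrix.toLpLin_apply, Matrix.mulVec, dotProduct]
    rw [h1, Matrix.mul_apply]
    by_cases hj : (j : ℕ) < M
    · rw [hcol j hj, Finset.sum_eq_single ⟨j, hj⟩]
      · simp [rectDiagonal, U, φ, RCLike.real_smul_eq_coe_mul, mul_comm]
      · intro b _ hb
        have : ¬ (b : ℕ) = j := fun h => hb (Fin.ext h)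
        simp [rectDiagonal, this]
      · simp
    · rw [hzero j (hrank _ (not_lt.mp hj)), Finset.sum_eq_zero]
      · simp
      · intro b _
        have : ¬ (b : ℕ) = j := fun h => hj (h ▸ b.isLt)
        simp [rectDiagonal, this]
  refine ⟨U, φ, V, hU, hV, fun j => T.singularValues_nonneg _,
    fun i j h => T.singularValues_antitone h, ?_⟩
  rw [← hAV, Matrix.mul_assoc, ← Matrix.star_eq_conjTranspose,
    (Matrix.mem_unitaryGroup_iff).mp hV, Matrix.mul_one]

/-- Singular value functional calculus: `𝔖_f(A) = U Σ_{f(φ)} V^*`, where `A = U Σ_φ V^*` is a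
singular value decomposition. For `f 0 = 0` the result does not depend on the decomposition, see
`singularValueCalculus_eq`. -/
noncomputable def singularValueCalculus {𝕜 : Type*} [RCLike 𝕜] {M N : ℕ} (f : ℝ → ℝ)
    (A : Matrix (Fin M) (Fin N) 𝕜) : Matrix (Fin M) (Fin N) 𝕜 :=
  let U := (exists_isSVD A).choose
  let φ := (exists_isSVD A).choose_spec.choose
  let V := (exists_isSVD A).choose_spec.choose_spec.choose
  U * rectDiagonal 𝕜 (fun j => f (φ j)) * Vᴴ

theorem exists_singularValueCalculus_eq {𝕜 : Type*} [RCLike 𝕜] {M N : ℕ} (f : ℝ → ℝ)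
    (A : Matrix (Fin M) (Fin N) 𝕜) : ∃ U φ V, IsSVD A U φ V ∧
      singularValueCalculus f A = U * rectDiagonal 𝕜 (fun j => f (φ j)) * Vᴴ :=
  ⟨_, _, _, (exists_isSVD A).choose_spec.choose_spec.choose_spec, rfl⟩

theorem IsSVD.mul_aeval {𝕜 : Type*} [RCLike 𝕜] {M N : ℕ} {A : Matrix (Fin M) (Fin N) 𝕜}
    {U : Matrix (Fin M) (Fin M) 𝕜} {φ : Fin (min M N) → ℝ} {V : Matrix (Fin N) (Fin N) 𝕜}
    (h : IsSVD A U φ V) (p : Polynomial ℝ) :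
    A * Polynomial.aeval (Aᴴ * A) p =
      U * rectDiagonal 𝕜 (fun j => φ j * p.eval (φ j ^ 2)) * Vᴴ := by
  have hU : Uᴴ * U = 1 := Matrix.mem_unitaryGroup_iff'.mp h.unitary_left
  have hV : Vᴴ * V = 1 := Matrix.mem_unitaryGroup_iff'.mp h.unitary_right
  have hD : ∀ ψ : Fin (min M N) → ℝ, rectDiagonal 𝕜 ψ *
      ((rectDiagonal 𝕜 φ : Matrix (Fin M) (Fin N) 𝕜)ᴴ * rectDiagonal 𝕜 φ) =
      rectDiagonal 𝕜 (fun j => ψ j * φ j ^ 2) := by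
    intro ψ
    ext i j
    rw [← Matrix.mul_assoc, Matrix.mul_apply]
    by_cases hj : (j : ℕ) < M
    · rw [Finset.sum_eq_single ⟨j, hj⟩, Matrix.mul_apply, Finset.sum_eq_single j]
      · by_cases hij : (i : ℕ) = j
        · simp [rectDiagonal, hij]; ring
        · simp [rectDiagonal, hij]
      · intro b _ hb
        have : ¬ (j : ℕ) = b := fun h => hb (Fin.ext h.symm)
        simp [rectDiagonal, this]
      · simp
      · intro b _ hb
        have : ¬ (b : ℕ) = j := fun h => hb (Fin.ext h)
        simp [rectDiagonal, this]
      · simp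
    · rw [Finset.sum_eq_zero]
      · have : ¬ (i : ℕ) = j := fun h => hj (h ▸ i.isLt)
        simp [rectDiagonal, this]
      · intro b _
        have : ¬ (b : ℕ) = j := fun h => hj (h ▸ b.isLt)
        simp [rectDiagonal, this]
  have hpow : ∀ k : ℕ, A * (Aᴴ * A) ^ k =
      U * rectDiagonal 𝕜 (fun j => φ j * (φ j ^ 2) ^ k) * Vᴴ := by
    intro k
    induction k with
    | zero => simpa using h.eq_mul
    | succ k ih =>
      have hAA : Aᴴ * A = V * ((rectDiagonal 𝕜 φ : Matrix (Fin M) (Fin N) 𝕜)ᴴ *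
          rectDiagonal 𝕜 φ) * Vᴴ := by
        conv_lhs => rw [h.eq_mul]
        simp only [Matrix.conjTranspose_mul, Matrix.conjTranspose_conjTranspose, Matrix.mul_assoc]
        rw [← Matrix.mul_assoc Uᴴ, hU, Matrix.one_mul]
      rw [pow_succ, ← Matrix.mul_assoc, ih, hAA]
      have := hD (fun j => φ j * (φ j ^ 2) ^ k)
      simp only [mul_assoc, ← pow_succ] at this
      simp only [Matrix.mul_assoc]
      rw [← Matrix.mul_assoc Vᴴ V, hV, Matrix.one_mul, ← this]
      simp only [Matrix.mul_assoc]
  induction p using Polynomial.induction_on' with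
  | add p q hp hq =>
    rw [map_add, Matrix.mul_add, hp, hq, ← Matrix.add_mul, ← Matrix.mul_add]
    congr 2
    ext i j
    by_cases hij : (i : ℕ) = j <;> simp [rectDiagonal, hij, mul_add]
  | monomial k a =>
    rw [Polynomial.aeval_monomial, ← Algebra.smul_def, Matrix.mul_smul, hpow,
      ← Matrix.smul_mul, ← Matrix.mul_smul]
    congr 2
    ext i j
    by_cases hij : (i : ℕ) = j
    · simp [rectDiagonal, hij, RCLike.real_smul_eq_coe_mul]; ring
    · simp [rectDiagonal, hij]

/-- For `f 0 = 0` any singular value decomposition computes `𝔖_f(A)`. -/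
theorem singularValueCalculus_eq {𝕜 : Type*} [RCLike 𝕜] {M N : ℕ} {f : ℝ → ℝ} (hf : f 0 = 0)
    {A : Matrix (Fin M) (Fin N) 𝕜} {U : Matrix (Fin M) (Fin M) 𝕜} {φ : Fin (min M N) → ℝ}
    {V : Matrix (Fin N) (Fin N) 𝕜} (h : IsSVD A U φ V) :
    singularValueCalculus f A = U * rectDiagonal 𝕜 (fun j => f (φ j)) * Vᴴ := by
  classical
  obtain ⟨U', φ', V', h', heq⟩ := exists_singularValueCalculus_eq f A
  let S : Finset ℝ := Finset.univ.image φ ∪ Finset.univ.image φ'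
  have hS : ∀ x ∈ S, 0 ≤ x := by
    intro x hx
    simp only [S, Finset.mem_union, Finset.mem_image] at hx
    rcases hx with ⟨j, -, rfl⟩ | ⟨j, -, rfl⟩
    · exact h.nonneg j
    · exact h'.nonneg j
  let p : Polynomial ℝ := Lagrange.interpolate S (fun x => x ^ 2) (fun x => f x / x)
  have hp : ∀ x ∈ S, x * p.eval (x ^ 2) = f x := by
    intro x hx
    have hinj : Set.InjOn (fun x : ℝ => x ^ 2) S := by
      intro a ha b hb hab
      exact (pow_left_inj₀ (hS a ha) (hS b hb) two_ne_zero).mp hab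
    have : p.eval (x ^ 2) = f x / x := Lagrange.eval_interpolate_at_node _ hinj hx
    rw [this]
    by_cases h0 : x = 0
    · simp [h0, hf]
    · field_simp
  have e1 := h.mul_aeval p
  have e2 := h'.mul_aeval p
  have e3 : (fun j => φ j * p.eval (φ j ^ 2)) = fun j => f (φ j) := by
    funext j; exact hp _ (by simp [S])
  have e4 : (fun j => φ' j * p.eval (φ' j ^ 2)) = fun j => f (φ' j) := by
    funext j; exact hp _ (by simp [S])
  rw [heq, ← e4, ← e2, e1, e3]

/-- The scalar function `f_α` (for the parameter `σ₀`) applied to the singular values. -/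
noncomputable def shrinkage (σ₀ α x : ℝ) : ℝ :=
  if x < σ₀ then 0
  else if x < (1 + α / 2) * σ₀ then 2 / α * (x - σ₀)
  else (1 + α / 2)⁻¹ * x

/-- The functional `𝒩_F(X) = σ₀² rank X + ‖X - F‖²` (Frobenius norm). -/
noncomputable def rankObjective {𝕜 : Type*} [RCLike 𝕜] {M N : ℕ} (σ₀ : ℝ)
    (F X : Matrix (Fin M) (Fin N) 𝕜) : ℝ :=
  σ₀ ^ 2 * (X.rank : ℝ) + ‖X - F‖ ^ 2

/-- The Fenchel conjugate `f^*(y) = sup_x (Re ⟪x, y⟫ - f x)`. -/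
noncomputable def fenchelConjugate (𝕜 : Type*) [RCLike 𝕜] {E : Type*} [NormedAddCommGroup E]
    [InnerProductSpace 𝕜 E] (f : E → EReal) (y : E) : EReal :=
  ⨆ x : E, ((RCLike.re (inner 𝕜 x y) : ℝ) : EReal) - f x

/-- The set of minimizers of `f` over `s`. -/
def argminOn {E : Type*} (s : Set E) (f : E → EReal) : Set E :=
  {x | x ∈ s ∧ ∀ y ∈ s, f x ≤ f y}

section DualAscent

/-- A nonexpansive map of a finite dimensional space has a fixed point if the solutions of
`x = t • T x`, `0 < t < 1`, are bounded. -/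
theorem exists_fixedPoint_of_lipschitzWith_one {E : Type*} [NormedAddCommGroup E]
    [NormedSpace ℝ E] [ProperSpace E] {T : E → E} (hT : LipschitzWith 1 T) {R : ℝ}
    (hR : ∀ x : E, ∀ t : ℝ, 0 < t → t < 1 → x = t • T x → ‖x‖ ≤ R) : ∃ x, T x = x := by
  let t : ℕ → ℝ := fun n => 1 - 1 / ((n : ℝ) + 2)
  have ht0 : ∀ n, 0 < t n := fun n => by
    have : (1 : ℝ) / ((n : ℝ) + 2) < 1 := by
      rw [div_lt_one (by positivity)]; linarith [n.cast_nonneg (α := ℝ)]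
    simp only [t]; linarith
  have ht1 : ∀ n, t n < 1 := fun n => by
    have : (0 : ℝ) < 1 / ((n : ℝ) + 2) := by positivity
    simp only [t]; linarith
  have htlim : Tendsto t atTop (𝓝 1) := by
    have h1 : Tendsto (fun n : ℕ => (1 : ℝ) / ((n : ℝ) + 2)) atTop (𝓝 0) := by
      refine tendsto_const_nhds.div_atTop ?_
      exact tendsto_atTop_add_const_right _ _ tendsto_natCast_atTop_atTop
    simpa [t] using h1.const_sub 1
  have hfix : ∀ n, ∃ x, x = t n • T x := by
    intro n
    have hc : ContractingWith ⟨t n, (ht0 n).le⟩ (fun x => t n • T x) := by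
      refine ⟨ht1 n, LipschitzWith.of_dist_le_mul fun x y => ?_⟩
      rw [dist_smul₀, Real.norm_of_nonneg (ht0 n).le]
      exact mul_le_mul_of_nonneg_left (by simpa using hT.dist_le_mul x y) (ht0 n).le
    exact ⟨_, hc.fixedPoint_isFixedPt.symm⟩
  choose x hx using hfix
  have hmem : ∀ n, x n ∈ Metric.closedBall (0 : E) R := fun n => by
    simpa using hR _ _ (ht0 n) (ht1 n) (hx n)
  obtain ⟨y, -, φ, hφ, hy⟩ := (isCompact_closedBall (0 : E) R).tendsto_subseq hmem
  refine ⟨y, ?_⟩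
  have h1 : Tendsto (fun n => t (φ n) • T (x (φ n))) atTop (𝓝 ((1 : ℝ) • T y)) :=
    (htlim.comp hφ.tendsto_atTop).smul ((hT.continuous.tendsto y).comp hy)
  have h2 : (fun n => t (φ n) • T (x (φ n))) = x ∘ φ := by
    funext n; exact (hx (φ n)).symm
  rw [h2, one_smul] at h1
  exact tendsto_nhds_unique h1 hy

variable {𝕜 E : Type*} [RCLike 𝕜] [NormedAddCommGroup E] [InnerProductSpace 𝕜 E]

theorem re_inner_starProjection_right (K : Submodule 𝕜 E) [K.HasOrthogonalProjection]
    {d : E} (hd : d ∈ K) (x : E) :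
    RCLike.re (inner 𝕜 d (K.starProjection x)) = RCLike.re (inner 𝕜 d x) := by
  rw [← K.inner_starProjection_left_eq_right, Submodule.starProjection_eq_self_iff.mpr hd]

/-- One step of dual ascent for a cocoercive map. -/
theorem norm_sq_add_smul_starProjection_le [NormedSpace ℝ E] [IsScalarTower ℝ 𝕜 E]
    (K : Submodule 𝕜 E)
    [K.HasOrthogonalProjection] {α : ℝ} (hα : 0 < α) {d x : E} (hd : d ∈ K)
    (h : α * ‖x‖ ^ 2 ≤ -RCLike.re (inner 𝕜 d x)) :
    ‖d + α • K.starProjection x‖ ^ 2 ≤ ‖d‖ ^ 2 - α ^ 2 * ‖x‖ ^ 2 := by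
  have h1 : α • K.starProjection x = (α : 𝕜) • K.starProjection x :=
    (RCLike.real_smul_eq_coe_smul α _)
  have h2 : ‖K.starProjection x‖ ≤ ‖x‖ := K.norm_starProjection_apply_le x
  have h3 : ‖K.starProjection x‖ ^ 2 ≤ ‖x‖ ^ 2 := by gcongr
  rw [h1, norm_add_sq (𝕜 := 𝕜), inner_smul_right, RCLike.re_ofReal_mul,
    re_inner_starProjection_right K hd, norm_smul, mul_pow, RCLike.norm_ofReal, sq_abs]
  nlinarith [mul_le_mul_of_nonneg_left h3 (sq_nonneg α), mul_le_mul_of_nonneg_left h hα.le]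

/-- Convergence of dual ascent `Λ ↦ Λ + α P (G Λ)` onto a point of `K` with `P (G Λ) = 0`. -/
theorem exists_tendsto_dualAscent [NormedSpace ℝ E] [IsScalarTower ℝ 𝕜 E] [ProperSpace E]
    (K : Submodule 𝕜 E) [K.HasOrthogonalProjection] {α : ℝ} (hα : 0 < α) {G : E → E}
    (hG : ∀ a b, α * ‖G a - G b‖ ^ 2 ≤ -RCLike.re (inner 𝕜 (a - b) (G a - G b)))
    {R : ℝ} (hR : ∀ a, 0 ≤ RCLike.re (inner 𝕜 a (G a)) → ‖a‖ ≤ R)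
    {X Λ : ℕ → E} (hΛ_zero : Λ 0 = 0) (hX : ∀ n, X (n + 1) = G (Λ n))
    (hΛ : ∀ n, Λ (n + 1) = Λ n + α • K.starProjection (X (n + 1))) :
    ∃ Λstar ∈ K, K.starProjection (G Λstar) = 0 ∧
      Tendsto X atTop (𝓝 (G Λstar)) ∧ Tendsto Λ atTop (𝓝 Λstar) := by
  have smul_mem : ∀ (r : ℝ) {v : E}, v ∈ K → r • v ∈ K := fun r v hv => by
    rw [RCLike.real_smul_eq_coe_smul (K := 𝕜)]; exact K.smul_mem _ hv
  have proj_mem : ∀ v, K.starProjection v ∈ K := K.starProjection_apply_mem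
  have hcont : Continuous G := by
    refine (LipschitzWith.of_dist_le_mul (K := ⟨α⁻¹, by positivity⟩) fun a b => ?_).continuous
    rw [dist_eq_norm, dist_eq_norm]
    change _ ≤ α⁻¹ * _
    rw [inv_mul_eq_div, le_div_iff₀ hα]
    by_cases h0 : ‖G a - G b‖ = 0
    · rw [h0]; simp
    · have h1 : 0 < ‖G a - G b‖ := lt_of_le_of_ne (norm_nonneg _) (Ne.symm h0)
      have h2 := hG a b
      have h3 := (abs_le.mp ((RCLike.abs_re_le_norm _).trans
        (norm_inner_le_norm (𝕜 := 𝕜) (a - b) (G a - G b)))).1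
      refine le_of_mul_le_mul_right ?_ h1
      nlinarith
  obtain ⟨L₀, hL₀K, hL₀⟩ : ∃ L ∈ K, K.starProjection (G L) = 0 := by
    let T : E → E := fun a => K.starProjection a +
      α • K.starProjection (G (K.starProjection a))
    have hTK : ∀ a, T a ∈ K := fun a => K.add_mem (proj_mem _) (smul_mem _ (proj_mem _))
    have hT : LipschitzWith 1 T := by
      refine LipschitzWith.of_dist_le_mul fun a b => ?_
      rw [NNReal.coe_one, one_mul, dist_eq_norm, dist_eq_norm]
      have e : T a - T b = K.starProjection (a - b) + α • K.starProjection
          (G (K.starProjection a) - G (K.starProjection b)) := by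
        simp only [T, map_sub, smul_sub]; abel
      have h1 := norm_sq_add_smul_starProjection_le K hα (proj_mem (a - b))
        (x := G (K.starProjection a) - G (K.starProjection b))
        (by rw [map_sub]; exact hG _ _)
      rw [e]
      refine le_trans ?_ (K.norm_starProjection_apply_le (a - b))
      refine le_of_sq_le_sq ?_ (norm_nonneg _)
      refine h1.trans ?_
      have : 0 ≤ α ^ 2 * ‖G (K.starProjection a) - G (K.starProjection b)‖ ^ 2 := by positivity
      linarith
    obtain ⟨L, hL⟩ := exists_fixedPoint_of_lipschitzWith_one hT (R := R) (by
      intro a t ht0 ht1 ha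
      have haK : a ∈ K := by rw [ha]; exact smul_mem _ (hTK a)
      have hPa : K.starProjection a = a := Submodule.starProjection_eq_self_iff.mpr haK
      apply hR
      have h1 : (1 - t) • a = (t * α) • K.starProjection (G a) := by
        have : a = t • a + t • (α • K.starProjection (G a)) := by
          conv_lhs => rw [ha]
          simp only [T, hPa, smul_add]
        rw [sub_smul, one_smul, mul_smul, sub_eq_iff_eq_add']
        exact this
      have h2 := congrArg (fun v => RCLike.re (inner 𝕜 a v)) h1
      rw [RCLike.real_smul_eq_coe_smul (K := 𝕜), RCLike.real_smul_eq_coe_smul (K := 𝕜),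
        inner_smul_right, inner_smul_right, RCLike.re_ofReal_mul, RCLike.re_ofReal_mul,
        re_inner_starProjection_right K haK, inner_self_eq_norm_sq] at h2
      have h3 : 0 ≤ (1 - t) * ‖a‖ ^ 2 := mul_nonneg (by linarith) (sq_nonneg _)
      rw [h2] at h3
      exact nonneg_of_mul_nonneg_right h3 (by positivity))
    have hLK : L ∈ K := hL ▸ hTK L
    refine ⟨L, hLK, ?_⟩
    have hPL : K.starProjection L = L := Submodule.starProjection_eq_self_iff.mpr hLK
    have : L + α • K.starProjection (G L) = L := by
      have := hL; simp only [T, hPL] at this; exact this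
    exact (smul_eq_zero.mp (add_eq_left.mp this)).resolve_left hα.ne'
  have hΛK : ∀ n, Λ n ∈ K := by
    intro n
    induction n with
    | zero => rw [hΛ_zero]; exact K.zero_mem
    | succ n ih => rw [hΛ]; exact K.add_mem ih (smul_mem _ (proj_mem _))
  have fejer : ∀ L ∈ K, K.starProjection (G L) = 0 → ∀ n,
      ‖Λ (n + 1) - L‖ ^ 2 ≤ ‖Λ n - L‖ ^ 2 - α ^ 2 * ‖G (Λ n) - G L‖ ^ 2 := by
    intro L hLK hL n
    have h1 := norm_sq_add_smul_starProjection_le K hα (K.sub_mem (hΛK n) hLK) (hG (Λ n) L)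
    rwa [map_sub, hL, sub_zero, sub_add_eq_add_sub, ← hX, ← hΛ, hX] at h1
  have anti : ∀ L ∈ K, K.starProjection (G L) = 0 → Antitone fun n => ‖Λ n - L‖ ^ 2 := by
    intro L hLK hL
    refine antitone_nat_of_succ_le fun n => (fejer L hLK hL n).trans ?_
    have : 0 ≤ α ^ 2 * ‖G (Λ n) - G L‖ ^ 2 := by positivity
    linarith
  have hXlim : Tendsto (fun n => G (Λ n)) atTop (𝓝 (G L₀)) := by
    obtain ⟨l, hl⟩ : ∃ l, Tendsto (fun n => ‖Λ n - L₀‖ ^ 2) atTop (𝓝 l) :=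
      ⟨_, tendsto_atTop_ciInf (anti L₀ hL₀K hL₀) ⟨0, by rintro _ ⟨n, rfl⟩; positivity⟩⟩
    have h1 : Tendsto (fun n => (‖Λ n - L₀‖ ^ 2 - ‖Λ (n + 1) - L₀‖ ^ 2) / α ^ 2) atTop (𝓝 0) := by
      simpa using (hl.sub (hl.comp (tendsto_add_atTop_nat 1))).div_const (α ^ 2)
    have h2 : Tendsto (fun n => ‖G (Λ n) - G L₀‖ ^ 2) atTop (𝓝 0) := by
      refine squeeze_zero (fun n => by positivity) (fun n => ?_) h1
      rw [le_div_iff₀ (by positivity)]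
      linarith [fejer L₀ hL₀K hL₀ n]
    rw [tendsto_iff_norm_sub_tendsto_zero]
    simpa using h2.sqrt
  have hbdd : ∀ n, Λ n ∈ Metric.closedBall L₀ ‖Λ 0 - L₀‖ := fun n => by
    rw [mem_closedBall_iff_norm]
    exact le_of_sq_le_sq (anti L₀ hL₀K hL₀ (Nat.zero_le n)) (norm_nonneg _)
  obtain ⟨L, -, φ, hφ, hLlim⟩ := (isCompact_closedBall L₀ ‖Λ 0 - L₀‖).tendsto_subseq hbdd
  have hLK : L ∈ K := by
    have h1 : Tendsto (fun n => K.starProjection (Λ (φ n))) atTop (𝓝 (K.starProjection L)) :=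
      (K.starProjection.continuous.tendsto L).comp hLlim
    simp only [fun n => Submodule.starProjection_eq_self_iff.mpr (hΛK n)] at h1
    exact Submodule.starProjection_eq_self_iff.mp (tendsto_nhds_unique h1 hLlim)
  have hGL : G L = G L₀ :=
    tendsto_nhds_unique ((hcont.tendsto L).comp hLlim) (hXlim.comp hφ.tendsto_atTop)
  have hL : K.starProjection (G L) = 0 := hGL ▸ hL₀
  refine ⟨L, hLK, hL, ?_, ?_⟩
  · rw [← tendsto_add_atTop_iff_nat 1]
    simpa only [hX, hGL] using hXlim
  · have h1 : Tendsto (fun n => ‖Λ n - L‖ ^ 2) atTop (𝓝 0) := by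
      have h2 : Tendsto (fun n => ‖Λ (φ n) - L‖ ^ 2) atTop (𝓝 0) := by
        simpa using (tendsto_iff_norm_sub_tendsto_zero.mp hLlim).pow 2
      have h3 := tendsto_atTop_ciInf (anti L hLK hL) ⟨0, by rintro _ ⟨n, rfl⟩; positivity⟩
      exact tendsto_nhds_unique (h3.comp hφ.tendsto_atTop) h2 ▸ h3
    rw [tendsto_iff_norm_sub_tendsto_zero]
    simpa using h1.sqrt

end DualAscent

section ThinSVD

variable {𝕜 : Type*} [RCLike 𝕜] {m n k : Type*} [Fintype m] [Fintype n] [Fintype k]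

theorem frobenius_inner_eq_trace (A B : Matrix m n 𝕜) : inner 𝕜 A B = (Aᴴ * B).trace := by
  simp only [Matrix.trace, Matrix.diag, Matrix.mul_apply, Matrix.conjTranspose_apply]
  rw [Finset.sum_comm]
  rfl

/-- A rectangular diagonal matrix factors through the square diagonal matrix. -/
theorem exists_thin_factor {M N : ℕ} {U : Matrix (Fin M) (Fin M) 𝕜}
    {V : Matrix (Fin N) (Fin N) 𝕜} (hU : U ∈ Matrix.unitaryGroup (Fin M) 𝕜)
    (hV : V ∈ Matrix.unitaryGroup (Fin N) 𝕜) :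
    ∃ (P : Matrix (Fin M) (Fin (min M N)) 𝕜) (Q : Matrix (Fin N) (Fin (min M N)) 𝕜),
      Pᴴ * P = 1 ∧ Qᴴ * Q = 1 ∧ ∀ φ : Fin (min M N) → ℝ,
        U * rectDiagonal 𝕜 φ * Vᴴ = P * diagonal (fun j => (φ j : 𝕜)) * Qᴴ := by
  let e (L : ℕ) : Matrix (Fin L) (Fin (min M N)) 𝕜 :=
    Matrix.of fun i j => if (i : ℕ) = j then 1 else 0
  have he : ∀ L, min M N ≤ L → (e L)ᴴ * e L = 1 := by
    intro L hL
    ext i j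
    rw [Matrix.mul_apply, Finset.sum_eq_single ⟨i, i.isLt.trans_le hL⟩]
    · simp [e, Matrix.one_apply, Fin.ext_iff]
    · intro b _ hb
      have : ¬ (b : ℕ) = i := fun h => hb (Fin.ext h)
      simp [e, this]
    · simp
  have hrect : ∀ φ : Fin (min M N) → ℝ, (rectDiagonal 𝕜 φ : Matrix (Fin M) (Fin N) 𝕜) =
      e M * diagonal (fun j => (φ j : 𝕜)) * (e N)ᴴ := by
    intro φ
    ext i j
    rw [Matrix.mul_apply]
    simp only [Matrix.mul_diagonal, Matrix.conjTranspose_apply]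
    by_cases hij : (i : ℕ) = j
    · rw [Finset.sum_eq_single ⟨i, lt_min i.isLt (lt_of_eq_of_lt hij j.isLt)⟩]
      · simp [rectDiagonal, e, hij]
      · intro b _ hb
        have : ¬ (i : ℕ) = b := fun h => hb (Fin.ext h.symm)
        simp [e, this]
      · simp
    · rw [Finset.sum_eq_zero]
      · simp [rectDiagonal, hij]
      · intro b _
        by_cases h : (i : ℕ) = b
        · have : ¬ (j : ℕ) = b := fun h' => hij (h.trans h'.symm)
          simp [e, this]
        · simp [e, h]
  refine ⟨U * e M, V * e N, ?_, ?_, fun φ => ?_⟩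
  · rw [Matrix.conjTranspose_mul, Matrix.mul_assoc, ← Matrix.mul_assoc Uᴴ,
      ← Matrix.star_eq_conjTranspose U, Matrix.mem_unitaryGroup_iff'.mp hU, Matrix.one_mul,
      he M (min_le_left _ _)]
  · rw [Matrix.conjTranspose_mul, Matrix.mul_assoc, ← Matrix.mul_assoc Vᴴ,
      ← Matrix.star_eq_conjTranspose V, Matrix.mem_unitaryGroup_iff'.mp hV, Matrix.one_mul,
      he N (min_le_right _ _)]
  · rw [hrect, Matrix.conjTranspose_mul]
    simp only [Matrix.mul_assoc]

variable [DecidableEq k]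

theorem re_inner_mul_diagonal_mul (P : Matrix m k 𝕜) (Q : Matrix n k 𝕜) (z : k → ℝ)
    (Y : Matrix m n 𝕜) :
    RCLike.re (inner 𝕜 (P * diagonal (fun j => (z j : 𝕜)) * Qᴴ) Y) =
      ∑ j, z j * RCLike.re ((Pᴴ * Y * Q) j j) := by
  rw [frobenius_inner_eq_trace, Matrix.conjTranspose_mul, Matrix.conjTranspose_mul,
    Matrix.conjTranspose_conjTranspose, Matrix.mul_assoc, Matrix.trace_mul_comm,
    Matrix.diagonal_conjTranspose]
  have : (diagonal (star fun j => (z j : 𝕜)) * Pᴴ * Y * Q) =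
      diagonal (fun j => (z j : 𝕜)) * (Pᴴ * Y * Q) := by
    rw [Matrix.mul_assoc, Matrix.mul_assoc, Matrix.mul_assoc]
    congr 2
    funext j
    simp
  rw [this, Matrix.trace, map_sum]
  refine Finset.sum_congr rfl fun j _ => ?_
  rw [Matrix.diag_apply, Matrix.diagonal_mul, RCLike.re_ofReal_mul]

theorem conjTranspose_mul_mul_diagonal_mul {P : Matrix m k 𝕜} {Q : Matrix n k 𝕜}
    (hP : Pᴴ * P = 1) (hQ : Qᴴ * Q = 1) (D : Matrix k k 𝕜) : Pᴴ * (P * D * Qᴴ) * Q = D := by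
  rw [Matrix.mul_assoc, Matrix.mul_assoc, hQ, Matrix.mul_one, ← Matrix.mul_assoc, hP,
    Matrix.one_mul]

theorem re_inner_thin {P : Matrix m k 𝕜} {Q : Matrix n k 𝕜}
    (hP : Pᴴ * P = 1) (hQ : Qᴴ * Q = 1) (z w : k → ℝ) :
    RCLike.re (inner 𝕜 (P * diagonal (fun j => (z j : 𝕜)) * Qᴴ)
      (P * diagonal (fun j => (w j : 𝕜)) * Qᴴ)) = ∑ j, z j * w j := by
  rw [re_inner_mul_diagonal_mul, conjTranspose_mul_mul_diagonal_mul hP hQ]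
  simp

theorem norm_sq_thin {P : Matrix m k 𝕜} {Q : Matrix n k 𝕜}
    (hP : Pᴴ * P = 1) (hQ : Qᴴ * Q = 1) (z : k → ℝ) :
    ‖P * diagonal (fun j => (z j : 𝕜)) * Qᴴ‖ ^ 2 = ∑ j, z j ^ 2 := by
  rw [← inner_self_eq_norm_sq (𝕜 := 𝕜), re_inner_thin hP hQ]
  simp only [sq]

theorem rank_thin {P : Matrix m k 𝕜} {Q : Matrix n k 𝕜}
    (hP : Pᴴ * P = 1) (hQ : Qᴴ * Q = 1) (z : k → ℝ) :
    ((P * diagonal (fun j => (z j : 𝕜)) * Qᴴ).rank : ℝ) = ∑ j, if z j = 0 then 0 else 1 := by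
  classical
  have h : (P * diagonal (fun j => (z j : 𝕜)) * Qᴴ).rank =
      (diagonal (fun j => (z j : 𝕜))).rank := by
    refine le_antisymm ((rank_mul_le_left _ _).trans (rank_mul_le_right _ _)) ?_
    conv_lhs => rw [← conjTranspose_mul_mul_diagonal_mul hP hQ (diagonal fun j => (z j : 𝕜))]
    exact (rank_mul_le_left _ _).trans (rank_mul_le_right _ _)
  rw [h, Matrix.rank_diagonal, Fintype.card_subtype, Finset.card_filter]
  push_cast
  refine Finset.sum_congr rfl fun j _ => ?_
  by_cases hz : z j = 0 <;> simp [hz]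

theorem sum_norm_sq_conjTranspose_mul_le_one {P P' : Matrix m k 𝕜} (hP : Pᴴ * P = 1)
    (hP' : P'ᴴ * P' = 1) (i : k) : ∑ j, ‖(Pᴴ * P') j i‖ ^ 2 ≤ 1 := by
  have key : ∀ (A B : Matrix m k 𝕜) (i j : k), inner 𝕜 (WithLp.toLp 2 (fun a => A a i))
      (WithLp.toLp 2 (fun a => B a j)) = (Aᴴ * B) i j := by
    intro A B i j
    simp [PiLp.inner_apply, Matrix.mul_apply, mul_comm]
  have hort : Orthonormal 𝕜 fun j : k => (WithLp.toLp 2 (fun a => P a j) : EuclideanSpace 𝕜 m) := by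
    rw [orthonormal_iff_ite]
    intro i j
    rw [key, hP, Matrix.one_apply]
  have h1 := hort.sum_inner_products_le (s := Finset.univ)
    (x := (WithLp.toLp 2 (fun a => P' a i) : EuclideanSpace 𝕜 m))
  simp only [key] at h1
  rwa [← inner_self_eq_norm_sq (𝕜 := 𝕜), key, hP', Matrix.one_apply_eq, RCLike.one_re] at h1

/-- A trace inequality of Ky Fan type, for two thin singular value decompositions. -/
theorem re_inner_thin_sub_le {P P' : Matrix m k 𝕜} {Q Q' : Matrix n k 𝕜}
    (hP : Pᴴ * P = 1) (hQ : Qᴴ * Q = 1) (hP' : P'ᴴ * P' = 1) (hQ' : Q'ᴴ * Q' = 1)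
    (z w : k → ℝ) (s : ℝ) :
    RCLike.re (inner 𝕜 (P * diagonal (fun j => (z j : 𝕜)) * Qᴴ)
      (P' * diagonal (fun j => (w j : 𝕜)) * Q'ᴴ)) -
      s ^ 2 * (∑ j, if z j = 0 then 0 else 1) - ∑ j, z j ^ 2 ≤
      ∑ j, max (w j ^ 2 / 4 - s ^ 2) 0 := by
  set a : k → k → ℝ := fun j i => ‖(Pᴴ * P') j i‖ ^ 2 with ha
  set b : k → k → ℝ := fun j i => ‖(Q'ᴴ * Q) i j‖ ^ 2 with hb
  have ha0 : ∀ j i, 0 ≤ a j i := fun j i => by positivity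
  have hb0 : ∀ j i, 0 ≤ b j i := fun j i => by positivity
  have hacol : ∀ i, ∑ j, a j i ≤ 1 := sum_norm_sq_conjTranspose_mul_le_one hP hP'
  have harow : ∀ j, ∑ i, a j i ≤ 1 := by
    intro j
    refine (Finset.sum_congr rfl fun i _ => ?_).trans_le
      (sum_norm_sq_conjTranspose_mul_le_one hP' hP j)
    have : (P'ᴴ * P) i j = star ((Pᴴ * P') j i) := by
      rw [← Matrix.conjTranspose_apply, Matrix.conjTranspose_mul,
        Matrix.conjTranspose_conjTranspose]
    rw [this, norm_star]
  have hbrow : ∀ j, ∑ i, b j i ≤ 1 := sum_norm_sq_conjTranspose_mul_le_one hQ' hQ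
  let δ : k → ℝ := fun j => if z j = 0 then 0 else 1
  have hδ0 : ∀ j, 0 ≤ δ j := fun j => by simp only [δ]; split_ifs <;> norm_num
  have hδ1 : ∀ j, δ j ≤ 1 := fun j => by simp only [δ]; split_ifs <;> norm_num
  have hentry : ∀ j, z j * RCLike.re ((Pᴴ * (P' * diagonal (fun j => (w j : 𝕜)) * Q'ᴴ) * Q) j j) ≤
      z j ^ 2 + ∑ i, δ j * a j i * (w i ^ 2 / 4) := by
    intro j
    have h1 : (Pᴴ * (P' * diagonal (fun j => (w j : 𝕜)) * Q'ᴴ) * Q) j j =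
        ∑ i, (w i : 𝕜) * ((Pᴴ * P') j i * (Q'ᴴ * Q) i j) := by
      have : Pᴴ * (P' * diagonal (fun j => (w j : 𝕜)) * Q'ᴴ) * Q =
          (Pᴴ * P') * diagonal (fun j => (w j : 𝕜)) * (Q'ᴴ * Q) := by
        simp only [Matrix.mul_assoc]
      rw [this, Matrix.mul_apply]
      refine Finset.sum_congr rfl fun i _ => ?_
      rw [Matrix.mul_diagonal]; ring
    rw [h1, map_sum, Finset.mul_sum]
    have h2 : ∀ i, z j * RCLike.re ((w i : 𝕜) * ((Pᴴ * P') j i * (Q'ᴴ * Q) i j)) ≤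
        z j ^ 2 * b j i + δ j * a j i * (w i ^ 2 / 4) := by
      intro i
      by_cases hz : z j = 0
      · simp [δ, hz]
      · have hδ : δ j = 1 := by simp [δ, hz]
        rw [hδ, RCLike.re_ofReal_mul]
        have h3 : |RCLike.re ((Pᴴ * P') j i * (Q'ᴴ * Q) i j)| ≤
            ‖(Pᴴ * P') j i‖ * ‖(Q'ᴴ * Q) i j‖ :=
          (RCLike.abs_re_le_norm _).trans (norm_mul _ _).le
        have h4 : z j * (w i * RCLike.re ((Pᴴ * P') j i * (Q'ᴴ * Q) i j)) ≤
            |z j| * |w i| * (‖(Pᴴ * P') j i‖ * ‖(Q'ᴴ * Q) i j‖) := by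
          rw [← mul_assoc]
          refine (le_abs_self _).trans ?_
          rw [abs_mul, abs_mul]
          exact mul_le_mul_of_nonneg_left h3 (by positivity)
        refine h4.trans ?_
        simp only [ha, hb]
        rw [← sq_abs (z j), ← sq_abs (w i)]
        nlinarith [sq_nonneg (|z j| * ‖(Q'ᴴ * Q) i j‖ - |w i| / 2 * ‖(Pᴴ * P') j i‖)]
    refine (Finset.sum_le_sum fun i _ => h2 i).trans ?_
    rw [Finset.sum_add_distrib, ← Finset.mul_sum]
    have := mul_le_mul_of_nonneg_left (hbrow j) (sq_nonneg (z j))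
    linarith
  have hsum : ∑ j, ∑ i, δ j * a j i * (w i ^ 2 / 4) - s ^ 2 * ∑ j, δ j ≤
      ∑ i, max (w i ^ 2 / 4 - s ^ 2) 0 := by
    have h1 : ∑ j, ∑ i, δ j * a j i * s ^ 2 ≤ s ^ 2 * ∑ j, δ j := by
      rw [Finset.mul_sum]
      refine Finset.sum_le_sum fun j _ => ?_
      rw [← Finset.sum_mul, ← Finset.mul_sum]
      nlinarith [mul_le_mul_of_nonneg_left (harow j) (mul_nonneg (hδ0 j) (sq_nonneg s))]
    have h2 : ∑ j, ∑ i, δ j * a j i * (w i ^ 2 / 4) - ∑ j, ∑ i, δ j * a j i * s ^ 2 =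
        ∑ i, (∑ j, δ j * a j i) * (w i ^ 2 / 4 - s ^ 2) := by
      rw [← Finset.sum_sub_distrib]
      simp only [← Finset.sum_sub_distrib, ← mul_sub, Finset.sum_mul]
      exact Finset.sum_comm
    have h3 : ∑ i, (∑ j, δ j * a j i) * (w i ^ 2 / 4 - s ^ 2) ≤
        ∑ i, max (w i ^ 2 / 4 - s ^ 2) 0 := by
      refine Finset.sum_le_sum fun i _ => ?_
      have h4 : 0 ≤ ∑ j, δ j * a j i := Finset.sum_nonneg fun j _ => mul_nonneg (hδ0 j) (ha0 j i)
      have h5 : ∑ j, δ j * a j i ≤ 1 :=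
        (Finset.sum_le_sum fun j _ => mul_le_of_le_one_left (ha0 j i) (hδ1 j)).trans (hacol i)
      calc (∑ j, δ j * a j i) * (w i ^ 2 / 4 - s ^ 2)
          ≤ (∑ j, δ j * a j i) * max (w i ^ 2 / 4 - s ^ 2) 0 :=
            mul_le_mul_of_nonneg_left (le_max_left _ _) h4
        _ ≤ max (w i ^ 2 / 4 - s ^ 2) 0 := mul_le_of_le_one_left (le_max_right _ _) h5
    linarith
  rw [re_inner_mul_diagonal_mul]
  have h := Finset.sum_le_sum fun j (_ : j ∈ Finset.univ) => hentry j
  rw [Finset.sum_add_distrib] at h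
  linarith

end ThinSVD

section Shrinkage

/-- Fenchel equality for the scalar function `z ↦ σ₀² [z ≠ 0] + z²`, at the points `x = f_α(φ)` and
`w = 2 φ - α x`. -/
theorem exists_shrinkage_mul_sub_add_le {σ₀ α φ : ℝ} (hσ₀ : 0 ≤ σ₀) (hα : 0 < α) (hφ : 0 ≤ φ)
    (a : ℝ) : ∃ z : ℝ, shrinkage σ₀ α φ * (a - (2 * φ - α * shrinkage σ₀ α φ)) +
      max ((2 * φ - α * shrinkage σ₀ α φ) ^ 2 / 4 - σ₀ ^ 2) 0 ≤
      z * a - σ₀ ^ 2 * (if z = 0 then 0 else 1) - z ^ 2 := by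
  unfold shrinkage
  split_ifs with h1 h2
  · refine ⟨0, ?_⟩
    rw [max_eq_right (by nlinarith)]
    simp
  · have hw : 2 * φ - α * (2 / α * (φ - σ₀)) = 2 * σ₀ := by field_simp; ring
    have hx0 : 0 ≤ 2 / α * (φ - σ₀) := mul_nonneg (by positivity) (by linarith)
    have hx1 : 2 / α * (φ - σ₀) ≤ σ₀ := by
      rw [div_mul_eq_mul_div, div_le_iff₀ hα]; linarith
    rw [hw, max_eq_right (by linarith)]
    by_cases ha : 2 * σ₀ ≤ a
    · refine ⟨σ₀, ?_⟩
      have : σ₀ ^ 2 * (if σ₀ = 0 then 0 else 1) = σ₀ ^ 2 := by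
        by_cases h0 : σ₀ = 0 <;> simp [h0]
      rw [this]
      nlinarith [mul_le_mul_of_nonneg_right hx1 (sub_nonneg.mpr ha)]
    · refine ⟨0, ?_⟩
      have := mul_nonneg hx0 (sub_nonneg.mpr (le_of_not_ge ha))
      simp; linarith
  · have hc : 0 < 1 + α / 2 := by positivity
    set x := (1 + α / 2)⁻¹ * φ with hx
    have hφx : φ = (1 + α / 2) * x := by rw [hx]; field_simp
    have hw : 2 * φ - α * x = 2 * x := by rw [hφx]; ring
    have hx1 : σ₀ ≤ x := by
      rw [hx, ← div_eq_inv_mul, le_div_iff₀ hc]; linarith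
    rw [hw, max_eq_left (by nlinarith)]
    refine ⟨x, ?_⟩
    have : σ₀ ^ 2 * (if x = 0 then (0 : ℝ) else 1) ≤ σ₀ ^ 2 :=
      mul_le_of_le_one_right (sq_nonneg _) (by split_ifs <;> norm_num)
    nlinarith

theorem abs_shrinkage_sub_le {σ₀ α φ : ℝ} (hσ₀ : 0 ≤ σ₀) (hα : 0 < α) (hφ : 0 ≤ φ) :
    |shrinkage σ₀ α φ - (1 + α / 2)⁻¹ * φ| ≤ (1 + α / 2)⁻¹ * σ₀ := by
  have hc : 0 < (1 + α / 2)⁻¹ := by positivity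
  unfold shrinkage
  split_ifs with h1 h2
  · rw [zero_sub, abs_neg, abs_of_nonneg (by positivity)]
    exact mul_le_mul_of_nonneg_left h1.le hc.le
  · have e : 2 / α * (φ - σ₀) - (1 + α / 2)⁻¹ * φ =
        (1 + α / 2)⁻¹ * (2 / α * (φ - (1 + α / 2) * σ₀)) := by field_simp; ring
    have h3 : 2 / α * (φ - (1 + α / 2) * σ₀) ≤ 0 :=
      mul_nonpos_of_nonneg_of_nonpos (by positivity) (by linarith)
    have h4 : -σ₀ ≤ 2 / α * (φ - (1 + α / 2) * σ₀) := by
      rw [div_mul_eq_mul_div, le_div_iff₀ hα]; linarith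
    rw [e, abs_mul, abs_of_pos hc]
    exact mul_le_mul_of_nonneg_left (abs_le.mpr ⟨h4, by linarith⟩) hc.le
  · rw [sub_self, abs_zero]; positivity

end Shrinkage

section Conjugate

variable {𝕜 : Type*} [RCLike 𝕜] {M N : ℕ}

theorem exists_thin_singularValueCalculus (f : ℝ → ℝ) (B : Matrix (Fin M) (Fin N) 𝕜) :
    ∃ (P : Matrix (Fin M) (Fin (min M N)) 𝕜) (Q : Matrix (Fin N) (Fin (min M N)) 𝕜)
      (φ : Fin (min M N) → ℝ), Pᴴ * P = 1 ∧ Qᴴ * Q = 1 ∧ (∀ j, 0 ≤ φ j) ∧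
      B = P * diagonal (fun j => (φ j : 𝕜)) * Qᴴ ∧
      singularValueCalculus f B = P * diagonal (fun j => ((f (φ j) : ℝ) : 𝕜)) * Qᴴ := by
  obtain ⟨U, φ, V, h, hf⟩ := exists_singularValueCalculus_eq f B
  obtain ⟨P, Q, hP, hQ, hPQ⟩ := exists_thin_factor h.unitary_left h.unitary_right
  exact ⟨P, Q, φ, hP, hQ, h.nonneg, h.eq_mul.trans (hPQ φ), hf.trans (hPQ _)⟩

theorem smul_thin_sub_smul_thin {m n k : Type*} [Fintype k] [DecidableEq k]
    (P : Matrix m k 𝕜) (Q : Matrix n k 𝕜) (a b : ℝ) (z w : k → ℝ) :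
    a • (P * diagonal (fun j => (z j : 𝕜)) * Qᴴ) - b • (P * diagonal (fun j => (w j : 𝕜)) * Qᴴ) =
      P * diagonal (fun j => ((a * z j - b * w j : ℝ) : 𝕜)) * Qᴴ := by
  have h : diagonal (fun j => ((a * z j - b * w j : ℝ) : 𝕜)) =
      a • diagonal (fun j => (z j : 𝕜)) - b • diagonal (fun j => (w j : 𝕜)) := by
    rw [← Matrix.diagonal_smul, ← Matrix.diagonal_smul, Matrix.diagonal_sub]
    congr 1
    funext j
    simp [RCLike.real_smul_eq_coe_mul]
  rw [h, Matrix.mul_sub, Matrix.sub_mul, Matrix.mul_smul, Matrix.mul_smul, Matrix.smul_mul,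
    Matrix.smul_mul]

theorem norm_singularValueCalculus_shrinkage_sub_le {σ₀ α : ℝ} (hσ₀ : 0 ≤ σ₀) (hα : 0 < α)
    (B : Matrix (Fin M) (Fin N) 𝕜) :
    ‖singularValueCalculus (shrinkage σ₀ α) B - (1 + α / 2)⁻¹ • B‖ ≤
      √(min M N : ℕ) * ((1 + α / 2)⁻¹ * σ₀) := by
  obtain ⟨P, Q, φ, hP, hQ, hφ, hB, hf⟩ := exists_thin_singularValueCalculus (shrinkage σ₀ α) B
  have h := smul_thin_sub_smul_thin P Q 1 (1 + α / 2)⁻¹ (fun j => shrinkage σ₀ α (φ j)) φ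
  rw [← hf, ← hB, one_smul] at h
  refine le_of_sq_le_sq ?_ (by positivity)
  rw [h, norm_sq_thin hP hQ, mul_pow, Real.sq_sqrt (Nat.cast_nonneg _)]
  refine (Finset.sum_le_card_nsmul _ _ (((1 + α / 2)⁻¹ * σ₀) ^ 2) fun j _ => ?_).trans ?_
  · rw [one_mul]
    exact sq_le_sq' (abs_le.mp (abs_shrinkage_sub_le hσ₀ hα (hφ j))).1
      (abs_le.mp (abs_shrinkage_sub_le hσ₀ hα (hφ j))).2
  · simp

theorem rankObjective_eq (σ₀ : ℝ) (F Z : Matrix (Fin M) (Fin N) 𝕜) :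
    rankObjective σ₀ F Z = σ₀ ^ 2 * (Z.rank : ℝ) + ‖Z‖ ^ 2 -
      2 * RCLike.re (inner 𝕜 Z F) + ‖F‖ ^ 2 := by
  rw [rankObjective, norm_sub_sq (𝕜 := 𝕜)]; ring

/-- `2 B - α X - 2 F` is a subgradient of `𝒩_F^{**}` at `X = 𝔖_{f_α}(B)`. -/
theorem exists_affine_minorant {σ₀ α : ℝ} (hσ₀ : 0 ≤ σ₀) (hα : 0 < α)
    (F B : Matrix (Fin M) (Fin N) 𝕜) {X V : Matrix (Fin M) (Fin N) 𝕜}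
    (hX : X = singularValueCalculus (shrinkage σ₀ α) B)
    (hV : V = (2 : ℝ) • B - α • X - (2 : ℝ) • F) :
    ∃ c : ℝ, fenchelConjugate 𝕜 (fenchelConjugate 𝕜 (fun Z => (rankObjective σ₀ F Z : EReal))) X =
        ((RCLike.re (inner 𝕜 X V) - c : ℝ) : EReal) ∧
      ∀ Y, ((RCLike.re (inner 𝕜 Y V) - c : ℝ) : EReal) ≤
        fenchelConjugate 𝕜 (fenchelConjugate 𝕜 (fun Z => (rankObjective σ₀ F Z : EReal))) Y := by
  obtain ⟨P, Q, φ, hP, hQ, hφ, hB, hf⟩ := exists_thin_singularValueCalculus (shrinkage σ₀ α) B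
  rw [← hX] at hf
  set x : Fin (min M N) → ℝ := fun j => shrinkage σ₀ α (φ j) with hx
  set w : Fin (min M N) → ℝ := fun j => 2 * φ j - α * x j with hw
  set W : Matrix (Fin M) (Fin N) 𝕜 := P * diagonal (fun j => (w j : 𝕜)) * Qᴴ with hWdef
  have hW : (2 : ℝ) • B - α • X = W := by
    rw [hB, hf]; exact smul_thin_sub_smul_thin P Q 2 α φ x
  have hVW : ∀ Z, RCLike.re (inner 𝕜 Z V) =
      RCLike.re (inner 𝕜 Z W) - 2 * RCLike.re (inner 𝕜 Z F) := by
    intro Z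
    rw [hV, hW, inner_sub_right, map_sub, RCLike.real_smul_eq_coe_smul (K := 𝕜),
      inner_smul_right, RCLike.re_ofReal_mul]
  let c : ℝ := ∑ j, max (w j ^ 2 / 4 - σ₀ ^ 2) 0 - ‖F‖ ^ 2
  have upper : fenchelConjugate 𝕜 (fun Z => (rankObjective σ₀ F Z : EReal)) V ≤ (c : EReal) := by
    refine iSup_le fun Z => ?_
    rw [← EReal.coe_sub, EReal.coe_le_coe_iff, rankObjective_eq, hVW]
    obtain ⟨P', Q', ψ, hP', hQ', -, hZ, -⟩ := exists_thin_singularValueCalculus id Z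
    have h1 := re_inner_thin_sub_le hP' hQ' hP hQ ψ w σ₀
    rw [← norm_sq_thin hP' hQ' ψ, ← rank_thin hP' hQ' ψ, ← hZ, ← hWdef] at h1
    simp only [c]
    linarith
  have lower : ∀ Y, ((RCLike.re (inner 𝕜 X Y) - (RCLike.re (inner 𝕜 X V) - c) : ℝ) : EReal) ≤
      fenchelConjugate 𝕜 (fun Z => (rankObjective σ₀ F Z : EReal)) Y := by
    intro Y
    let a : Fin (min M N) → ℝ := fun j => RCLike.re ((Pᴴ * (Y + (2 : ℝ) • F) * Q) j j)
    have hYF : ∀ Z, RCLike.re (inner 𝕜 Z (Y + (2 : ℝ) • F)) =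
        RCLike.re (inner 𝕜 Z Y) + 2 * RCLike.re (inner 𝕜 Z F) := by
      intro Z
      rw [inner_add_right, map_add, RCLike.real_smul_eq_coe_smul (K := 𝕜),
        inner_smul_right, RCLike.re_ofReal_mul]
    choose z hz using fun j => exists_shrinkage_mul_sub_add_le hσ₀ hα (hφ j) (a j)
    have hsum : ∑ j, (x j * (a j - w j) + max (w j ^ 2 / 4 - σ₀ ^ 2) 0) ≤
        ∑ j, (z j * a j - σ₀ ^ 2 * (if z j = 0 then 0 else 1) - z j ^ 2) :=
      Finset.sum_le_sum fun j _ => hz j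
    simp only [Finset.sum_add_distrib, Finset.sum_sub_distrib, mul_sub, ← Finset.mul_sum] at hsum
    have hXa := re_inner_mul_diagonal_mul P Q x (Y + (2 : ℝ) • F)
    have hXw := re_inner_thin hP hQ x w
    rw [← hf] at hXa hXw
    rw [hYF] at hXa
    rw [← hWdef] at hXw
    have hZa := re_inner_mul_diagonal_mul P Q z (Y + (2 : ℝ) • F)
    rw [hYF] at hZa
    rw [← rank_thin hP hQ z, ← norm_sq_thin hP hQ z] at hsum
    refine le_trans ?_ (le_iSup _ (P * diagonal (fun j => (z j : 𝕜)) * Qᴴ))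
    rw [← EReal.coe_sub, EReal.coe_le_coe_iff, rankObjective_eq, hVW]
    simp only [c]
    linarith
  have minorant : ∀ Y, ((RCLike.re (inner 𝕜 Y V) - c : ℝ) : EReal) ≤
      fenchelConjugate 𝕜 (fenchelConjugate 𝕜 (fun Z => (rankObjective σ₀ F Z : EReal))) Y := by
    intro Y
    refine le_trans ?_ (le_iSup _ V)
    rw [EReal.coe_sub, inner_re_symm]
    exact EReal.sub_le_sub le_rfl upper
  refine ⟨c, le_antisymm (iSup_le fun Y => ?_) (minorant X), minorant⟩
  refine (EReal.sub_le_sub le_rfl (lower Y)).trans ?_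
  rw [← EReal.coe_sub, EReal.coe_le_coe_iff, inner_re_symm]
  linarith

/-- Strong monotonicity of the subdifferential of `𝒩_F^{**} + α/2 ‖·‖²`, in its dual form. -/
theorem singularValueCalculus_shrinkage_cocoercive {σ₀ α : ℝ} (hσ₀ : 0 ≤ σ₀) (hα : 0 < α)
    (F a b : Matrix (Fin M) (Fin N) 𝕜) {x y : Matrix (Fin M) (Fin N) 𝕜}
    (hx : x = singularValueCalculus (shrinkage σ₀ α) (F - (1 / 2 : ℝ) • a))
    (hy : y = singularValueCalculus (shrinkage σ₀ α) (F - (1 / 2 : ℝ) • b)) :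
    α * ‖x - y‖ ^ 2 ≤ -RCLike.re (inner 𝕜 (a - b) (x - y)) := by
  have hv : ∀ a x : Matrix (Fin M) (Fin N) 𝕜,
      -a - α • x = (2 : ℝ) • (F - (1 / 2 : ℝ) • a) - α • x - (2 : ℝ) • F := by
    intro a x
    module
  obtain ⟨c, hc, hcY⟩ := exists_affine_minorant hσ₀ hα F _ hx (hv a x)
  obtain ⟨d, hd, hdY⟩ := exists_affine_minorant hσ₀ hα F _ hy (hv b y)
  have h1 := hcY y
  have h2 := hdY x
  rw [hd, EReal.coe_le_coe_iff] at h1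
  rw [hc, EReal.coe_le_coe_iff] at h2
  have h3 : 0 ≤ RCLike.re (inner 𝕜 (x - y) ((-a - α • x) - (-b - α • y))) := by
    simp only [inner_sub_left, inner_sub_right (𝕜 := 𝕜) _ (-a - α • x), map_sub]
    linarith
  have h4 : (-a - α • x) - (-b - α • y) = -(a - b) - (α : 𝕜) • (x - y) := by
    rw [← RCLike.real_smul_eq_coe_smul]; module
  rw [h4, inner_sub_right, inner_neg_right, inner_smul_right, map_sub, map_neg,
    RCLike.re_ofReal_mul, inner_self_eq_norm_sq, inner_re_symm] at h3
  linarith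

theorem norm_le_of_re_inner_singularValueCalculus_nonneg {σ₀ α : ℝ} (hσ₀ : 0 ≤ σ₀) (hα : 0 < α)
    (F a : Matrix (Fin M) (Fin N) 𝕜)
    (h : 0 ≤ RCLike.re (inner 𝕜 a
      (singularValueCalculus (shrinkage σ₀ α) (F - (1 / 2 : ℝ) • a)))) :
    ‖a‖ ≤ 2 * (‖F‖ + √(min M N : ℕ) * σ₀) := by
  set x := singularValueCalculus (shrinkage σ₀ α) (F - (1 / 2 : ℝ) • a) with hx
  have hE := norm_singularValueCalculus_shrinkage_sub_le hσ₀ hα (F - (1 / 2 : ℝ) • a)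
  rw [← hx] at hE
  set c : ℝ := (1 + α / 2)⁻¹ with hc
  have hc0 : 0 < c := by positivity
  set e := x - c • (F - (1 / 2 : ℝ) • a) with he
  have hxe : x = ((c : ℝ) : 𝕜) • F - ((c / 2 : ℝ) : 𝕜) • a + e := by
    rw [he, ← RCLike.real_smul_eq_coe_smul, ← RCLike.real_smul_eq_coe_smul]; module
  rw [hxe, inner_add_right, inner_sub_right, inner_smul_right, inner_smul_right, map_add, map_sub,
    RCLike.re_ofReal_mul, RCLike.re_ofReal_mul, inner_self_eq_norm_sq] at h
  have h1 : RCLike.re (inner 𝕜 a F) ≤ ‖a‖ * ‖F‖ := re_inner_le_norm a F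
  have h2 : RCLike.re (inner 𝕜 a e) ≤ ‖a‖ * ‖e‖ := re_inner_le_norm a e
  have h3 : ‖a‖ * ‖e‖ ≤ ‖a‖ * (√(min M N : ℕ) * (c * σ₀)) :=
    mul_le_mul_of_nonneg_left hE (norm_nonneg _)
  have h4 := mul_le_mul_of_nonneg_left h1 hc0.le
  by_cases h0 : ‖a‖ = 0
  · rw [h0]; positivity
  · have h5 : 0 < ‖a‖ := lt_of_le_of_ne (norm_nonneg _) (Ne.symm h0)
    refine le_of_mul_le_mul_left ?_ (mul_pos hc0 h5)
    nlinarith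

end Conjugate

theorem mainTheorem4 {𝕜 : Type*} [RCLike 𝕜] {M N : ℕ} (σ₀ α : ℝ) (hσ₀ : 0 ≤ σ₀) (hα : 0 < α)
    (F : Matrix (Fin M) (Fin N) 𝕜) (S : Submodule 𝕜 (Matrix (Fin M) (Fin N) 𝕜))
    (X Λ : ℕ → Matrix (Fin M) (Fin N) 𝕜)
    (hΛ_zero : Λ 0 = 0)
    (hX : ∀ n, X (n + 1) =
      singularValueCalculus (shrinkage σ₀ α) (F - (1 / 2 : ℝ) • Λ n))
    (hΛ : ∀ n, Λ (n + 1) = Λ n + α • Sᗮ.starProjection (X (n + 1))) :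
    ∃ Xstar Λstar : Matrix (Fin M) (Fin N) 𝕜,
      Tendsto X atTop (𝓝 Xstar) ∧ Tendsto Λ atTop (𝓝 Λstar) ∧
      argminOn (S : Set (Matrix (Fin M) (Fin N) 𝕜))
        (fun Y => fenchelConjugate 𝕜 (fenchelConjugate 𝕜 (fun Z => (rankObjective σ₀ F Z : EReal))) Y
          + ((α / 2 * ‖Y‖ ^ 2 : ℝ) : EReal)) = {Xstar} := by
  have : ProperSpace (Matrix (Fin M) (Fin N) 𝕜) := FiniteDimensional.proper_rclike 𝕜 _
  obtain ⟨L, hL, hPL, hXlim, hΛlim⟩ := exists_tendsto_dualAscent (𝕜 := 𝕜) Sᗮ hα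
    (G := fun a => singularValueCalculus (shrinkage σ₀ α) (F - (1 / 2 : ℝ) • a))
    (fun a b => singularValueCalculus_shrinkage_cocoercive hσ₀ hα F a b rfl rfl)
    (fun a => norm_le_of_re_inner_singularValueCalculus_nonneg hσ₀ hα F a) hΛ_zero hX hΛ
  refine ⟨_, L, hXlim, hΛlim, ?_⟩
  set x := singularValueCalculus (shrinkage σ₀ α) (F - (1 / 2 : ℝ) • L) with hx
  have hxS : x ∈ S := by
    have := (Submodule.starProjection_apply_eq_zero_iff _).mp hPL
    rwa [Submodule.orthogonal_orthogonal] at this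
  obtain ⟨c, hc, hcY⟩ := exists_affine_minorant hσ₀ hα F _ hx
    (V := -L - α • x) (by module)
  have hin : ∀ Y ∈ S, RCLike.re (inner 𝕜 Y (-L - α • x)) = -α * RCLike.re (inner 𝕜 Y x) := by
    intro Y hY
    rw [inner_sub_right, inner_neg_right, Submodule.inner_right_of_mem_orthogonal hY hL,
      RCLike.real_smul_eq_coe_smul (K := 𝕜), inner_smul_right, neg_zero, zero_sub, map_neg,
      RCLike.re_ofReal_mul, neg_mul]
  rw [hin x hxS, inner_self_eq_norm_sq] at hc
  have hlow : ∀ Y ∈ S, ((-α * ‖x‖ ^ 2 - c + α / 2 * ‖x‖ ^ 2 + α / 2 * ‖Y - x‖ ^ 2 : ℝ) : EReal) ≤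
      fenchelConjugate 𝕜 (fenchelConjugate 𝕜 (fun Z => (rankObjective σ₀ F Z : EReal))) Y
        + ((α / 2 * ‖Y‖ ^ 2 : ℝ) : EReal) := by
    intro Y hY
    have e : -α * ‖x‖ ^ 2 - c + α / 2 * ‖x‖ ^ 2 + α / 2 * ‖Y - x‖ ^ 2 =
        (RCLike.re (inner 𝕜 Y (-L - α • x)) - c) + α / 2 * ‖Y‖ ^ 2 := by
      rw [hin Y hY, norm_sub_sq (𝕜 := 𝕜)]; ring
    rw [e, EReal.coe_add]
    exact add_le_add_left (hcY Y) _
  ext Y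
  simp only [argminOn, Set.mem_ofPred_eq, SetLike.mem_coe, Set.mem_singleton_iff]
  constructor
  · rintro ⟨hY, hmin⟩
    have h := (hlow Y hY).trans (hmin x hxS)
    rw [hc, ← EReal.coe_add, EReal.coe_le_coe_iff] at h
    have h1 : α / 2 * ‖Y - x‖ ^ 2 ≤ 0 := by linarith
    have h2 : ‖Y - x‖ ^ 2 ≤ 0 := nonpos_of_mul_nonpos_right h1 (by positivity)
    exact sub_eq_zero.mp (norm_eq_zero.mp (pow_eq_zero_iff two_ne_zero |>.mp
      (le_antisymm h2 (sq_nonneg _))))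
  · rintro rfl
    refine ⟨hxS, fun Z hZ => le_trans ?_ (hlow Z hZ)⟩
    rw [hc, ← EReal.coe_add, EReal.coe_le_coe_iff]
    have : 0 ≤ α / 2 * ‖Z - x‖ ^ 2 := by positivity
    linarith
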